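/- **Logics.** A logic $\mathcal L$ is given by first-order formulas of set theory (with a set parameter $p_{\mathcal L}$) that define: "$\varphi$ is an $\mathcal L$-formula", "the non-logical symbol $s$ occurs in $\varphi$", "$v$ is a free variable of $\varphi$", and the model relation $\mathfrak A\models_{\mathcal L}\varphi[a]$ ($\mathfrak A$ a non-empty first-order structure, $a$ an assignment to the free variables of $\varphi$). A signature $S$ is a set of constant, function and relation symbols; an $\mathcal L$-formula of signature $S$ is one all of whose non-logical symbols are in $S$; a sentence is a formula without free variables. $\mathcal L$ is *proper* if $\models_{\mathcal L}$ is invariant under isomorphism, depends only on the reduct of $\mathfrak A$ to any signature containing the symbols of $\varphi$, and, in each signature, every first-order sentence is equivalent to an $\mathcal L$-sentence and the $\mathcal L$-sentences are closed, up to equivalence, under negation and conjunction. $\mathcal L$ is *finitary* if every $\mathcal L$-formula has only finitely many free variables; for every infinite cardinal $\kappa$ and every signature $S$ with $|S|\le\kappa$ there are at most $\kappa$ many $\mathcal L$-formulas of signature $S$; and, for every infinite ordinal $\theta$ with $p_{\mathcal L}\in V_\theta$ and every $\varphi\in V_\theta$, $V_\theta\models$ "$\varphi$ is an $\mathcal L$-formula"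 if and only if $\varphi$ is an $\mathcal L$-formula. A transitive set $N$ with $\emptyset,p_{\mathcal L}\in N$ is *$\mathcal L$-truthful* if for every structure $\mathfrak A\in N$ and every $\mathcal L$-sentence $\varphi\in N$ in the signature of $\mathfrak A$, $N\models$ "$\mathfrak A\models_{\mathcal L}\varphi$" if and only if $\mathfrak A\models_{\mathcal L}\varphi$. **Weak compactness.** $\mathrm{WCS}(\mathcal L)$ is the class of cardinals $\kappa>\aleph_0$ such that for every set $T$ of $\mathcal L$-sentences in a signature with at most $\kappa$ many symbols, if every $T_0\subseteq T$ with $|T_0|<\kappa$ has a model, then $T$ has a model. $\mathrm{wcn}(\mathcal L)$ is the least element of $\mathrm{WCS}(\mathcal L)$, and $\infty$ if there is none. **Mahlo cardinals.** A cardinal $\kappa$ is weakly inaccessible if it is an uncountable regular limit cardinal, and weakly Mahlo if moreover the regular cardinals below $\kappa$ are stationary in $\kappa$. Let $\mathrm{WM}_0=\mathrm{WM}^*_0$ be the class of weakly Mahlo cardinals. The word "hyper" has two usages, and both are covered. Let $\mathrm{WM}_{n+1}$ be the class of weakly Mahlo $\kappa$ such that $\mathrm{WM}_n\cap\kappa$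 is stationary in $\kappa$. For a class $P$ of cardinals, let $\mathrm{M}^{\alpha}(P)$ be the class of $\kappa\in P$ such that $\mathrm{M}^\beta(P)\cap\kappa$ is stationary in $\kappa$ for all $\beta<\alpha$, and let $\mathrm{WM}^*_{n+1}$ be the class of $\kappa$ with $\kappa\in \mathrm{M}^{\kappa}(\mathrm{WM}^*_n)$. So $\mathrm{WM}_1$, respectively $\mathrm{WM}^*_1$, is the class of weakly hyper-Mahlo cardinals, $\mathrm{WM}_2$, respectively $\mathrm{WM}^*_2$, that of weakly hyper-hyper-Mahlo cardinals, and so on. **Proposition 3.4.** Suppose that $\mathcal L$ is a finitary proper logic such that - (3.8) for every regular uncountable cardinal $\theta$ with $p_{\mathcal L}\in V_\theta$, $V_\theta$ is $\mathcal L$-truthful; and - (3.9) well-foundedness of a binary relation is expressible in $\mathcal L$: for some binary relation symbol $E$ there is an $\mathcal L$-sentence of signature $\{E\}$ that holds in exactly those structures of signature $\{E\}$ in which $E$ is well-founded. Then: 1. If $\mathrm{wcn}(\mathcal L)<\infty$, then for every $n\in\mathbb N$ the classes $\mathrm{WM}_n$ and $\mathrm{WM}^*_n$ have a least element, and $\mathrm{wcn}(\mathcal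 L)$ is greater than it. 2. For every $n\in\mathbb N$, $(2^{\aleph_0})^{+n}\notin\mathrm{WCS}(\mathcal L)$. In particular $2^{\aleph_0}\notin\mathrm{WCS}(\mathcal L)$. -/

import Mathlib

open Cardinal
open scoped ZFSet FirstOrder

universe u

noncomputable section

/-! ### The language of set theory -/

/-- The relation symbols of the language of set theory: one binary symbol. -/
inductive MemRel : ℕ → Type
  | mem : MemRel 2

/-- The first-order language `{∈}` of set theory. -/
def setLang : FirstOrder.Language.{0, 0} := ⟨fun _ => Empty, MemRel⟩

/-- The universe of sets as an `∈`-structure. -/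
instance univSetStructure : setLang.Structure ZFSet.{u} where
  funMap := fun f _ => nomatch f
  RelMap := fun r => match r with
    | MemRel.mem => fun v => v 0 ∈ v 1

/-- A set `N` as an `∈`-structure `⟨N, ∈⟩`. -/
instance setSetStructure (N : ZFSet.{u}) : setLang.Structure N where
  funMap := fun f _ => nomatch f
  RelMap := fun r => match r with
    | MemRel.mem => fun v => (v 0 : ZFSet.{u}) ∈ (v 1 : ZFSet.{u})

/-! ### Signatures and structures, coded as sets -/

/-- The `n`-ary function symbol with name `x` (a constant symbol if `n = 0`). -/
def funSymb (n : ℕ) (x : ZFSet.{u}) : ZFSet.{u} :=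
  ZFSet.pair ∅ (ZFSet.pair (Ordinal.toZFSet n) x)

/-- The `n`-ary relation symbol with name `x`. -/
def relSymb (n : ℕ) (x : ZFSet.{u}) : ZFSet.{u} :=
  ZFSet.pair {∅} (ZFSet.pair (Ordinal.toZFSet n) x)

/-- A signature is a set of function symbols (including constants) and relation symbols. -/
def IsSignature (S : ZFSet.{u}) : Prop :=
  ∀ s ∈ S, ∃ (n : ℕ) (x : ZFSet.{u}), s = funSymb n x ∨ s = relSymb n x

/-- The first-order language with the symbols in `S`. -/
def sig (S : ZFSet.{u}) : FirstOrder.Language.{u + 1, u + 1} where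
  Functions n := {x : ZFSet.{u} // funSymb n x ∈ S}
  Relations n := {x : ZFSet.{u} // relSymb n x ∈ S}

/-- The inclusion of a smaller signature in a larger one. -/
def sigIncl {S S' : ZFSet.{u}} (h : S ⊆ S') : sig S →ᴸ sig S' where
  onFunction := fun _ f => ⟨f.1, h f.2⟩
  onRelation := fun _ r => ⟨r.1, h r.2⟩

/-- The binary relation symbol of the signature `{E}`, where `E` has name `x`. -/
def soleRel (x : ZFSet.{u}) : (sig {relSymb 2 x}).Relations 2 := ⟨x, ZFSet.mem_singleton.2 rfl⟩

/-- A finite sequence of sets as a set. -/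
def tupleCode {n : ℕ} (x : Fin n → ZFSet.{u}) : ZFSet.{u} :=
  ZFSet.range fun i : Fin n => ZFSet.pair (Ordinal.toZFSet (i : ℕ)) (x i)

theorem funSymb_injective (n : ℕ) : Function.Injective (funSymb.{u} n) := by
  intro x y h
  exact (ZFSet.pair_injective (ZFSet.pair_injective h).2).2

theorem relSymb_injective (n : ℕ) : Function.Injective (relSymb.{u} n) := by
  intro x y h
  exact (ZFSet.pair_injective (ZFSet.pair_injective h).2).2

instance small_sig_functions (S : ZFSet.{u}) (n : ℕ) : Small.{u} ((sig S).Functions n) :=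
  small_of_injective (β := S) (f := fun x => ⟨funSymb n x.1, x.2⟩) fun _ _ h =>
    Subtype.ext (funSymb_injective n (congrArg (fun z : S => (z : ZFSet.{u})) h))

instance small_sig_relations (S : ZFSet.{u}) (n : ℕ) : Small.{u} ((sig S).Relations n) :=
  small_of_injective (β := S) (f := fun x => ⟨relSymb n x.1, x.2⟩) fun _ _ h =>
    Subtype.ext (relSymb_injective n (congrArg (fun z : S => (z : ZFSet.{u})) h))

/-- The structure `𝔄` with underlying set `A` and signature `S`, as a set: the triple
`(S, A, I)` where `I` is the set of all `(f, (x, f(x)))` for function symbols `f` and of all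
`(r, x)` with `r(x)` true for relation symbols `r`. -/
def structCode (S A : ZFSet.{u}) [(sig S).Structure A] : ZFSet.{u} :=
  ZFSet.pair S (ZFSet.pair A
    (ZFSet.range (fun t : Σ n : ℕ, (sig S).Functions n × (Fin n → A) =>
        ZFSet.pair (funSymb t.1 t.2.1.1)
          (ZFSet.pair (tupleCode fun i => (t.2.2 i : ZFSet.{u}))
            (FirstOrder.Language.Structure.funMap t.2.1 t.2.2 : A))) ∪
      ZFSet.range (fun t : Σ n : ℕ,
          {q : (sig S).Relations n × (Fin n → A) // FirstOrder.Language.Structure.RelMap q.1 q.2} =>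
        ZFSet.pair (relSymb t.1 t.2.1.1.1)
          (tupleCode fun i => (t.2.1.2 i : ZFSet.{u})))))

/-- An assignment of elements of `A` to the variables in `D`, as a set of ordered pairs. -/
def assignCode {D A : ZFSet.{u}} (a : D → A) : ZFSet.{u} :=
  ZFSet.range fun v : D => ZFSet.pair v (a v)

/-! ### Logics -/

/-- A logic, given by its definition in set theory: formulas of the language `{∈}`, with a common
parameter, that define its syntax and its model relation. -/
structure DefLogic where
  /-- the parameter `p` of the definition -/
  param : ZFSet.{u}
  /-- `isForm(φ, p)`: `φ` is a formula of the logic -/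
  isForm : setLang.Formula (Fin 2)
  /-- `occurs(s, φ, p)`: the non-logical symbol `s` occurs in `φ` -/
  occurs : setLang.Formula (Fin 3)
  /-- `isFree(v, φ, p)`: `v` is a free variable of `φ` -/
  isFree : setLang.Formula (Fin 3)
  /-- `sat(𝔄, φ, a, p)`: `φ` holds in the structure `𝔄` under the assignment `a` of elements
  of `𝔄` to the free variables of `φ` -/
  sat : setLang.Formula (Fin 4)

namespace DefLogic

variable (L : DefLogic.{u})

/-- `φ` is an `L`-formula. -/
def IsForm (φ : ZFSet.{u}) : Prop := L.isForm.Realize ![φ, L.param]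

/-- The non-logical symbol `s` occurs in `φ`. -/
def Occurs (s φ : ZFSet.{u}) : Prop := L.occurs.Realize ![s, φ, L.param]

/-- `v` is a free variable of `φ`. -/
def IsFree (v φ : ZFSet.{u}) : Prop := L.isFree.Realize ![v, φ, L.param]

/-- The `L`-formulas of signature `S`. -/
def Formulas (S : ZFSet.{u}) : Set ZFSet.{u} := {φ | L.IsForm φ ∧ ∀ s, L.Occurs s φ → s ∈ S}

/-- The `L`-sentences of signature `S`. -/
def Sentences (S : ZFSet.{u}) : Set ZFSet.{u} := {φ ∈ L.Formulas S | ∀ v, ¬ L.IsFree v φ}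

/-- The model relation for formulas: `𝔄 ⊨_L φ[a]`, where `𝔄` has underlying set `A` and
signature `S` and `a` is an assignment to the set `D` of free variables of `φ`. -/
def Holds (S A : ZFSet.{u}) [(sig S).Structure A] (φ : ZFSet.{u}) {D : ZFSet.{u}} (a : D → A) :
    Prop :=
  L.sat.Realize ![structCode S A, φ, assignCode a, L.param]

/-- The model relation for sentences: `𝔄 ⊨_L φ`. The assignment is empty. -/
def Models (S A : ZFSet.{u}) [(sig S).Structure A] (φ : ZFSet.{u}) : Prop :=
  L.sat.Realize ![structCode S A, φ, ∅, L.param]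

/-- `L` is a proper logic: truth is preserved by isomorphisms and by the passage to a reduct
in which all symbols of the formula are still present, all first-order sentences are expressible,
and the sentences are closed, up to equivalence, under negation and conjunction. -/
structure IsProper : Prop where
  iso : ∀ S : ZFSet.{u}, IsSignature S → ∀ φ ∈ L.Formulas S,
    ∀ (D : ZFSet.{u}), (∀ v, v ∈ D ↔ L.IsFree v φ) →
    ∀ (A B : ZFSet.{u}) [Nonempty A] [Nonempty B] [(sig S).Structure A] [(sig S).Structure B]
      (e : A ≃[sig S] B) (a : D → A), L.Holds S A φ a ↔ L.Holds S B φ (fun v => e (a v))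
  reduct : ∀ (S S' : ZFSet.{u}) (h : S ⊆ S'), IsSignature S' → ∀ φ ∈ L.Formulas S,
    ∀ (D : ZFSet.{u}), (∀ v, v ∈ D ↔ L.IsFree v φ) →
    ∀ (A : ZFSet.{u}) [Nonempty A] [(sig S').Structure A] (a : D → A),
      (letI : (sig S).Structure A := (sigIncl h).reduct A; L.Holds S A φ a) ↔ L.Holds S' A φ a
  firstOrder : ∀ S : ZFSet.{u}, IsSignature S → ∀ ψ : (sig S).Sentence,
    ∃ φ ∈ L.Sentences S, ∀ (A : ZFSet.{u}) [Nonempty A] [(sig S).Structure A],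
      L.Models S A φ ↔ A ⊨ ψ
  neg : ∀ S : ZFSet.{u}, IsSignature S → ∀ φ ∈ L.Sentences S,
    ∃ χ ∈ L.Sentences S, ∀ (A : ZFSet.{u}) [Nonempty A] [(sig S).Structure A],
      L.Models S A χ ↔ ¬ L.Models S A φ
  conj : ∀ S : ZFSet.{u}, IsSignature S → ∀ φ ∈ L.Sentences S, ∀ ψ ∈ L.Sentences S,
    ∃ χ ∈ L.Sentences S, ∀ (A : ZFSet.{u}) [Nonempty A] [(sig S).Structure A],
      L.Models S A χ ↔ L.Models S A φ ∧ L.Models S A ψ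

/-- `L` is finitary: formulas have finitely many free variables; there are at most `κ` formulas in
a signature of size at most `κ`, for infinite `κ`; and for infinite `θ` the set `V_θ` (if it
contains the parameter of `L`) is right about which of its elements are `L`-formulas. -/
structure IsFinitary : Prop where
  finite_free : ∀ φ, L.IsForm φ → {v | L.IsFree v φ}.Finite
  card_formulas : ∀ κ : Cardinal.{u}, ℵ₀ ≤ κ → ∀ S : ZFSet.{u}, IsSignature S → S.card ≤ κ →
    #(L.Formulas S) ≤ Cardinal.lift.{u + 1} κ
  isForm_absolute : ∀ θ : Ordinal.{u}, Ordinal.omega0 ≤ θ →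
    ∀ (hp : L.param ∈ V_ θ) (φ : ZFSet.{u}) (hφ : φ ∈ V_ θ),
      L.isForm.Realize (M := V_ θ) ![⟨φ, hφ⟩, ⟨L.param, hp⟩] ↔ L.IsForm φ

/-- A transitive set `N` containing the parameter of `L` is `L`-truthful if
`N ⊨ "𝔄 ⊨_L φ"` is equivalent to `𝔄 ⊨_L φ`, for all structures `𝔄 ∈ N` and all sentences `φ ∈ N`
in the signature of `𝔄`. (As `N` is transitive, the restriction of `𝔄` to `N` is `𝔄`.) -/
def IsTruthful (N : ZFSet.{u}) (hp : L.param ∈ N) (h0 : ∅ ∈ N) : Prop :=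
  ∀ (S A : ZFSet.{u}) [Nonempty A] [(sig S).Structure A], IsSignature S →
    ∀ (hA : structCode S A ∈ N) (φ : ZFSet.{u}) (hφ : φ ∈ N), φ ∈ L.Sentences S →
      (L.sat.Realize (M := N) ![⟨structCode S A, hA⟩, ⟨φ, hφ⟩, ⟨∅, h0⟩, ⟨L.param, hp⟩] ↔
        L.Models S A φ)

/-- For every regular uncountable cardinal `θ`, the set `V_θ` is `L`-truthful (if it contains the
parameter of `L`, as the notion of truthfulness presupposes). -/
def TruthfulAtRegular : Prop :=
  ∀ θ : Cardinal.{u}, ℵ₀ < θ → θ.IsRegular →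
    ∀ (hp : L.param ∈ V_ θ.ord) (h0 : ∅ ∈ V_ θ.ord), L.IsTruthful (V_ θ.ord) hp h0

/-- Well-foundedness of a binary relation is expressible in `L`: for some binary relation symbol
`E` there is a sentence in the signature `{E}` whose models are the structures in which `E` is
well-founded. -/
def ExpressesWellFounded : Prop :=
  ∃ x : ZFSet.{u}, ∃ φ ∈ L.Sentences {relSymb 2 x},
    ∀ (A : ZFSet.{u}) [Nonempty A] [(sig {relSymb 2 x}).Structure A],
      L.Models {relSymb 2 x} A φ ↔
        WellFounded fun a b : A => FirstOrder.Language.Structure.RelMap (soleRel x) ![a, b]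

/-! ### Weak compactness -/

/-- The set `T` of sentences of signature `S` has a model. -/
def Satisfiable (S : ZFSet.{u}) (T : Set ZFSet.{u}) : Prop :=
  ∃ (A : ZFSet.{u}) (_ : Nonempty A) (_ : (sig S).Structure A), ∀ φ ∈ T, L.Models S A φ

/-- The weak compactness spectrum. -/
def WCS : Set Cardinal.{u} :=
  {κ | ℵ₀ < κ ∧ ∀ S : ZFSet.{u}, IsSignature S → S.card ≤ κ → ∀ T ⊆ L.Sentences S,
    (∀ T₀ ⊆ T, #T₀ < Cardinal.lift.{u + 1} κ → L.Satisfiable S T₀) → L.Satisfiable S T}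

/-- The weak compactness number; `⊤` stands for `∞`. -/
def wcn : WithTop Cardinal.{u} := sInf ((fun κ : Cardinal.{u} => (κ : WithTop Cardinal.{u})) '' L.WCS)

end DefLogic

/-! ### Mahlo cardinals -/

/-- `κ` is weakly inaccessible: an uncountable regular limit cardinal. -/
def IsWeaklyInaccessible (κ : Cardinal.{u}) : Prop :=
  ℵ₀ < κ ∧ κ.IsRegular ∧ Order.IsSuccLimit κ

/-- The set of cardinals below `κ` with property `P` is stationary in `κ`. -/
def StationaryBelow (P : Cardinal.{u} → Prop) (κ : Cardinal.{u}) : Prop :=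
  IsStationary {x : Set.Iio κ.ord | ∃ l : Cardinal.{u}, P l ∧ l.ord = x.1}

/-- `κ` is weakly Mahlo. -/
def IsWeaklyMahlo (κ : Cardinal.{u}) : Prop :=
  IsWeaklyInaccessible κ ∧ StationaryBelow Cardinal.IsRegular κ

/-- Weakly hyper-...-hyper-Mahlo with `n` times "hyper", where each "hyper" asks for stationarily
many cardinals of the previous kind. -/
def IsWeaklyHyperMahlo : ℕ → Cardinal.{u} → Prop
  | 0 => IsWeaklyMahlo
  | n + 1 => fun κ => IsWeaklyMahlo κ ∧ StationaryBelow (IsWeaklyHyperMahlo n) κ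

/-- The transfinite iteration of the Mahlo operation, starting from the class `P`: the cardinal `κ`
is in the `α`-th class if it is in `P` and the `β`-th class is stationary below `κ`, for all
`β < α`. -/
def MahloIter (P : Cardinal.{u} → Prop) (α : Ordinal.{u}) (κ : Cardinal.{u}) : Prop :=
  P κ ∧ ∀ β : Set.Iio α, StationaryBelow (MahloIter P β.1) κ
termination_by α
decreasing_by exact β.2

/-- Weakly hyper-...-hyper-Mahlo with `n` times "hyper", in the other usage of the word, where each
"hyper" diagonalizes: `κ` lies in the `κ`-th iterate of the Mahlo operation on the previous
class. -/
def IsWeaklyDiagHyperMahlo : ℕ → Cardinal.{u} → Prop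
  | 0 => IsWeaklyMahlo
  | n + 1 => fun κ => MahloIter (IsWeaklyDiagHyperMahlo n) κ.ord κ

end

/-! Let `κ` be in the spectrum. Expand the ordinals up to `κ` by countably many relations `Q i β x`,
constants for all elements, and one extra constant, interpreted by `p` in the structure number `p <
κ`. A sentence saying that the extra constant differs from `α` fails in only one of these
structures. Hence compactness yields a well-founded model `M` of all sentences failing in at most
one of them (`exists_wellFounded_model`). The constants give an order embedding `j` of the ordinals
up to `κ` into `M`, and the extra constant is a new element below `j κ`.

Let `l ≤ κ` be least with a new element below `j l`, and let `d` be the least such element, so that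
the predecessors of `d` are exactly the `j α` with `α < l`. As with the normal ultrafilter derived
from an elementary embedding, a class whose image contains `d` satisfies Fodor's lemma at `l`.
Skolem functions for regressive functions with bounded fibres make this a statement about the chosen
sentences, and well-foundedness allows the converse transfer: largeness at `l` is seen in `M` as
largeness at `d`. Thus `d` inherits every property that follows from largeness of properties it
already has (`IsReflectionPoint`).

Largeness of the trivial class at a point already makes that point regular and uncountable. So `d`
is "regular", then "weakly Mahlo", and each Mahlo-type operation can be repeated. A class containing
`d` is large at `l`, so it has members below `l ≤ κ`; this is the first claim.

For the second claim, `l` is itself weakly Mahlo, so `l ≤ (2^ℵ₀)^{+n}` forces `l ≤ 2^ℵ₀`. Then `d`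
lies below the image of the continuum and codes a set of natural numbers. That set is already listed
at some `δ` below the continuum, and so `d = j δ`, which is impossible. -/

noncomputable section

/-! ### Transfer from abstract languages to coded signatures -/

namespace SymbolCoding

variable (Λ : FirstOrder.Language.{u + 1, u + 1}) (name : Λ.Symbols → ZFSet.{u})

/-- The coded symbol with the given name. -/
def symb : Λ.Symbols → ZFSet.{u}
  | Sum.inl f => funSymb f.1 (name (Sum.inl f))
  | Sum.inr r => relSymb r.1 (name (Sum.inr r))

/-- The signature coding an abstract language. -/
def signature [Small.{u} Λ.Symbols] : ZFSet.{u} := ZFSet.range (symb Λ name)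

variable [Small.{u} Λ.Symbols]

theorem isSignature_signature : IsSignature (signature Λ name) := by
  intro s hs
  obtain ⟨t, rfl⟩ := ZFSet.mem_range.1 hs
  rcases t with f | r
  · exact ⟨f.1, _, Or.inl rfl⟩
  · exact ⟨r.1, _, Or.inr rfl⟩

/-- The map from an abstract language into its code. -/
def toSig : Λ →ᴸ sig (signature Λ name) where
  onFunction := fun n f => ⟨name (Sum.inl ⟨n, f⟩), ZFSet.mem_range.2 ⟨Sum.inl ⟨n, f⟩, rfl⟩⟩
  onRelation := fun n r => ⟨name (Sum.inr ⟨n, r⟩), ZFSet.mem_range.2 ⟨Sum.inr ⟨n, r⟩, rfl⟩⟩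

variable {name}

theorem toSig_injective (hname : Function.Injective name) : (toSig Λ name).Injective where
  onFunction := by
    intro n f g h
    have h' := hname (congrArg Subtype.val h)
    simpa using h'
  onRelation := by
    intro n f g h
    have h' := hname (congrArg Subtype.val h)
    simpa using h'

theorem card_signature_le {κ : Cardinal.{u}} (hcard : #Λ.Symbols ≤ Cardinal.lift.{u + 1} κ) :
    (signature Λ name).card ≤ κ := by
  have h := ZFSet.lift_card_range_le (f := symb Λ name)
  rw [Cardinal.lift_id'.{u, u + 1}] at h
  exact Cardinal.lift_le.1 (h.trans hcard)

end SymbolCoding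

/-- Any language with at most `κ` symbols can be named by sets, with a prescribed name for one
symbol. -/
theorem exists_symbol_names {X : Type (u + 1)} {κ : Cardinal.{u}}
    (hcard : #X ≤ Cardinal.lift.{u + 1} κ) (e : X) (x : ZFSet.{u}) :
    Small.{u} X ∧ ∃ name : X → ZFSet.{u}, Function.Injective name ∧ name e = x := by
  classical
  have h : #X ≤ #(Set.Iio κ.ord) := by simpa using hcard
  obtain ⟨g⟩ := h
  refine ⟨small_of_injective g.injective, ?_⟩
  let f : X → ZFSet.{u} := fun y => (g y : Ordinal.{u}).toZFSet
  have hf : Function.Injective f := fun a b hab =>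
    g.injective (Subtype.ext (Ordinal.toZFSet_injective hab))
  -- Swapping two values preserves injectivity and gives `e` the name that the well-foundedness
  -- sentence requires.
  exact ⟨fun y => Equiv.swap (f e) x (f y), (Equiv.injective _).comp hf, Equiv.swap_apply_left _ _⟩

theorem assignCode_of_isEmpty {D A : ZFSet.{u}} [IsEmpty D] (a : D → A) : assignCode a = ∅ := by
  ext z
  simp [assignCode]

/-! ### Compactness for many structures on one set -/

namespace DefLogic

variable {L : DefLogic.{u}}

theorem IsProper.models_reduct (hL : L.IsProper) {S S' : ZFSet.{u}} (h : S ⊆ S')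
    (hS' : IsSignature S') {φ : ZFSet.{u}} (hφ : φ ∈ L.Sentences S) (A : ZFSet.{u}) [Nonempty A]
    [(sig S').Structure A] :
    (letI : (sig S).Structure A := (sigIncl h).reduct A; L.Models S A φ) ↔ L.Models S' A φ := by
  have : IsEmpty (∅ : ZFSet.{u}) := ⟨fun v => ZFSet.notMem_empty v.1 v.2⟩
  have key := hL.reduct S S' h hS' φ hφ.1 ∅
    (fun v => ⟨fun hv => (ZFSet.notMem_empty v hv).elim, fun hv => (hφ.2 v hv).elim⟩) A
    (fun v => isEmptyElim v)
  simpa only [Holds, Models, assignCode_of_isEmpty] using key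

theorem sentences_mono {S S' : ZFSet.{u}} (h : S ⊆ S') : L.Sentences S ⊆ L.Sentences S' :=
  fun _ hφ => ⟨⟨hφ.1.1, fun s hs => h (hφ.1.2 s hs)⟩, hφ.2⟩

open FirstOrder Language in
/-- If `κ` lies in the weak compactness spectrum of a logic expressing well-foundedness, and
`κ` many structures on the same set interpret `E` by a well-founded relation, then there is a
model, well-founded in the same sense, of all sentences that fail in at most one of them. -/
theorem exists_wellFounded_model (hL : L.IsProper) (hwf : L.ExpressesWellFounded)
    {κ : Cardinal.{u}} (hκ : κ ∈ L.WCS) {Λ : FirstOrder.Language.{u + 1, u + 1}}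
    (hcard : #Λ.Symbols ≤ Cardinal.lift.{u + 1} κ) (E : Λ.Relations 2)
    {O : ZFSet.{u}} [Nonempty O] {J : Type (u + 1)} (str : J → Λ.Structure O)
    (hJ : Cardinal.lift.{u + 1} κ ≤ #J)
    (hE : ∀ j, WellFounded fun a b : O => (str j).RelMap E ![a, b]) :
    ∃ (M : Type (u + 1)) (_ : Nonempty M) (_ : Λ.Structure M),
      (WellFounded fun a b : M => Structure.RelMap E ![a, b]) ∧
      ∀ ψ : Λ.Sentence,
        (∀ i j, ¬ (letI := str i; O ⊨ ψ) → ¬ (letI := str j; O ⊨ ψ) → i = j) → M ⊨ ψ := by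
  classical
  obtain ⟨x, φwf, hφwf, hφwf_iff⟩ := hwf
  obtain ⟨hsmall, name, hname, hnameE⟩ := exists_symbol_names hcard (Sum.inr ⟨2, E⟩) x
  set S := SymbolCoding.signature Λ name with hS
  have hsig : IsSignature S := SymbolCoding.isSignature_signature Λ name
  have hSx : ({relSymb 2 x} : ZFSet.{u}) ⊆ S := by
    intro s hs
    rw [ZFSet.mem_singleton] at hs
    subst hs
    exact ZFSet.mem_range.2 ⟨Sum.inr ⟨2, E⟩, by simp [SymbolCoding.symb, hnameE]⟩
  let ι : Λ →ᴸ sig S := SymbolCoding.toSig Λ name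
  have hι : ι.Injective := SymbolCoding.toSig_injective Λ hname
  have hEx : (sigIncl hSx).onRelation (soleRel x) = ι.onRelation E :=
    Subtype.ext hnameE.symm
  have models_wf : ∀ (A : ZFSet.{u}) [Nonempty A] [(sig S).Structure A], L.Models S A φwf ↔
      WellFounded fun a b : A => Structure.RelMap (ι.onRelation E) ![a, b] := by
    intro A _ _
    rw [← hL.models_reduct hSx hsig hφwf A, ← hEx]
    exact @hφwf_iff A _ ((sigIncl hSx).reduct A)
  have : Inhabited O := Classical.inhabited_of_nonempty inferInstance
  -- Default values for symbols outside the range of `ι` make surjectivity of `ι` unnecessary.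
  let str' : J → (sig S).Structure O := fun j => letI := str j; ι.defaultExpansion O
  have hexp : ∀ j, @LHom.IsExpansionOn Λ (sig S) ι O (str j) (str' j) := fun j =>
    let := str j; hι.isExpansionOn_default O
  let T : Set ZFSet.{u} := {φ ∈ L.Sentences S |
    ∀ i j, ¬ (letI := str' i; L.Models S O φ) → ¬ (letI := str' j; L.Models S O φ) → i = j}
  obtain ⟨A, hA, strA, hAT⟩ := hκ.2 S hsig (SymbolCoding.card_signature_le Λ hcard) T
    (fun _ h => h.1) (by
      intro T₀ hT₀ hcardT
      by_contra hno
      -- If `T₀` had no model, each structure would refute some member of `T₀`. No member is refuted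
      -- twice, so `J` would inject into `T₀`.
      have hfail : ∀ j, ∃ φ : T₀, ¬ (letI := str' j; L.Models S O φ) := by
        intro j
        by_contra hj
        push Not at hj
        exact hno ⟨O, inferInstance, str' j, fun φ hφ => hj ⟨φ, hφ⟩⟩
      choose f hf using hfail
      have hfinj : Function.Injective f := fun i j hij =>
        (hT₀ (f i).2).2 i j (hf i) (by rw [hij]; exact hf j)
      exact absurd (hJ.trans (Cardinal.mk_le_of_injective hfinj)) (not_le.2 hcardT))
  let strM : Λ.Structure A := ι.reduct A
  refine ⟨A, hA, strM, ?_, fun ψ hψ => ?_⟩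
  · refine (models_wf A).1 (hAT φwf ⟨sentences_mono hSx hφwf, fun i j hi _ => (hi ?_).elim⟩)
    let := str i
    let := str' i
    have := hexp i
    rw [models_wf O]
    simpa only [LHom.map_onRelation] using hE i
  · obtain ⟨φ, hφ, hφ_iff⟩ := hL.firstOrder S hsig (ι.onSentence ψ)
    rw [← ι.realize_onSentence A, ← hφ_iff A]
    refine hAT φ ⟨hφ, fun i j hi hj => hψ i j (fun h => hi ?_) (fun h => hj ?_)⟩
    · let := str i
      let := str' i
      have := hexp i
      exact (hφ_iff O).2 ((ι.realize_onSentence O ψ).2 h)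
    · let := str j
      let := str' j
      have := hexp j
      exact (hφ_iff O).2 ((ι.realize_onSentence O ψ).2 h)

end DefLogic

/-! ### Regressive functions with bounded fibres -/

/-- On the elements of `P` below `l`, the function `k` is regressive (`l` is allowed as an extra
value), and `b` bounds its fibres below `l`. -/
def BoundedFibres (P : Ordinal.{u} → Prop) (l : Ordinal.{u}) (k b : Ordinal.{u} → Ordinal.{u}) :
    Prop :=
  ∀ z < l, P z → (k z < z ∨ k z = l) ∧ z ≤ b (k z) ∧ b (k z) < l

/-- Every regressive function on `P` below `l` has an unbounded fibre. -/
def FodorLarge (P : Ordinal.{u} → Prop) (l : Ordinal.{u}) : Prop :=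
  ∀ k b : Ordinal.{u} → Ordinal.{u}, ¬ BoundedFibres P l k b

theorem exists_boundedFibres (P : Ordinal.{u} → Prop) (l : Ordinal.{u}) :
    ∃ kb : (Ordinal.{u} → Ordinal.{u}) × (Ordinal.{u} → Ordinal.{u}),
      ¬ FodorLarge P l → BoundedFibres P l kb.1 kb.2 := by
  by_cases h : FodorLarge P l
  · exact ⟨(id, id), fun h' => (h' h).elim⟩
  · simp only [FodorLarge, not_forall, not_not] at h
    obtain ⟨k, b, hkb⟩ := h
    exact ⟨(k, b), fun _ => hkb⟩

/-- A regressive function on `P` below `l` with bounded fibres, if there is one. -/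
def regr (P : Ordinal.{u} → Prop) (l : Ordinal.{u}) : Ordinal.{u} → Ordinal.{u} :=
  (exists_boundedFibres P l).choose.1

/-- Bounds for the fibres of `regr P l`, if possible. -/
def fibreBound (P : Ordinal.{u} → Prop) (l : Ordinal.{u}) : Ordinal.{u} → Ordinal.{u} :=
  (exists_boundedFibres P l).choose.2

theorem boundedFibres_regr {P : Ordinal.{u} → Prop} {l : Ordinal.{u}} (h : ¬ FodorLarge P l) :
    BoundedFibres P l (regr P l) (fibreBound P l) :=
  (exists_boundedFibres P l).choose_spec h

/-! ### A language for families of binary relations on an ordinal -/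

/-- Function symbols: constants for the elements of `O` and one more, and Skolem functions. -/
inductive ReflFun (O : Type (u + 1)) : ℕ → Type (u + 1)
  | const (o : Option O) : ReflFun O 0
  | regr (i : ℕ) : ReflFun O 3
  | bound (i : ℕ) : ReflFun O 3

/-- Relation symbols: an order, and for each `i` a binary relation and its largeness. -/
inductive ReflRel : ℕ → Type (u + 1)
  | lt : ReflRel 2
  | rel (i : ℕ) : ReflRel 2
  | large (i : ℕ) : ReflRel 2

/-- The language used for reflection arguments. -/
def reflLang (O : Type (u + 1)) : FirstOrder.Language.{u + 1, u + 1} := ⟨ReflFun O, ReflRel⟩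

namespace Refl

open FirstOrder Language

variable {O : Type (u + 1)}

section Vocabulary

variable {X : Type (u + 1)} [(reflLang O).Structure X]

/-- The interpretation of the order symbol. -/
def lt (O : Type (u + 1)) {X : Type (u + 1)} [(reflLang O).Structure X] (x y : X) : Prop :=
  Structure.RelMap (L := reflLang O) (M := X) (ReflRel.lt : (reflLang O).Relations 2) ![x, y]

/-- The interpretation of the `i`-th binary relation symbol. -/
def rel (O : Type (u + 1)) {X : Type (u + 1)} [(reflLang O).Structure X] (i : ℕ) (x y : X) : Prop :=
  Structure.RelMap (L := reflLang O) (M := X) (ReflRel.rel i : (reflLang O).Relations 2) ![x, y]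

/-- The interpretation of the symbol for largeness of the `i`-th relation. -/
def large (O : Type (u + 1)) {X : Type (u + 1)} [(reflLang O).Structure X] (i : ℕ) (x y : X) :
    Prop :=
  Structure.RelMap (L := reflLang O) (M := X) (ReflRel.large i : (reflLang O).Relations 2) ![x, y]

/-- The interpretation of the constants. -/
def con (O : Type (u + 1)) {X : Type (u + 1)} [(reflLang O).Structure X] (o : Option O) : X :=
  Structure.funMap (L := reflLang O) (M := X) (ReflFun.const o : (reflLang O).Functions 0) ![]

/-- The interpretation of the Skolem function for regressive functions. -/
def reg (O : Type (u + 1)) {X : Type (u + 1)} [(reflLang O).Structure X] (i : ℕ) (x y z : X) : X :=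
  Structure.funMap (L := reflLang O) (M := X) (ReflFun.regr i : (reflLang O).Functions 3) ![x, y, z]

/-- The interpretation of the Skolem function for fibre bounds. -/
def bnd (O : Type (u + 1)) {X : Type (u + 1)} [(reflLang O).Structure X] (i : ℕ) (x y z : X) : X :=
  Structure.funMap (L := reflLang O) (M := X) (ReflFun.bound i : (reflLang O).Functions 3) ![x, y, z]

end Vocabulary

section Formulas

variable {n : ℕ}

/-- Terms in `n` variables. -/
abbrev Tm (O : Type (u + 1)) (n : ℕ) := (reflLang O).Term (Empty ⊕ Fin n)
/-- Formulas in `n` variables. -/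
abbrev Fm (O : Type (u + 1)) (n : ℕ) := (reflLang O).BoundedFormula Empty n

/-- `s < t`. -/
def ltF (s t : Tm O n) : Fm O n :=
  Relations.boundedFormula₂ (ReflRel.lt : (reflLang O).Relations 2) s t
/-- The `i`-th relation holds of `s` and `t`. -/
def relF (i : ℕ) (s t : Tm O n) : Fm O n :=
  Relations.boundedFormula₂ (ReflRel.rel i : (reflLang O).Relations 2) s t
/-- The `i`-th relation at the parameter `s` is large below `t`. -/
def largeF (i : ℕ) (s t : Tm O n) : Fm O n :=
  Relations.boundedFormula₂ (ReflRel.large i : (reflLang O).Relations 2) s t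
/-- A constant as a term. -/
def conT (o : Option O) : Tm O n := Term.func (ReflFun.const o : (reflLang O).Functions 0) ![]
/-- An application of the `i`-th regressive function. -/
def regT (i : ℕ) (r s t : Tm O n) : Tm O n :=
  Term.func (ReflFun.regr i : (reflLang O).Functions 3) ![r, s, t]
/-- An application of the `i`-th fibre bound. -/
def bndT (i : ℕ) (r s t : Tm O n) : Tm O n :=
  Term.func (ReflFun.bound i : (reflLang O).Functions 3) ![r, s, t]

variable {X : Type (u + 1)} [(reflLang O).Structure X] (v : Empty → X) (xs : Fin n → X)
  (i : ℕ) (r s t : Tm O n)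

@[simp] theorem realize_ltF : (ltF s t).Realize v xs ↔
    lt O (s.realize (Sum.elim v xs)) (t.realize (Sum.elim v xs)) :=
  BoundedFormula.realize_rel₂
@[simp] theorem realize_relF : (relF i s t).Realize v xs ↔
    rel O i (s.realize (Sum.elim v xs)) (t.realize (Sum.elim v xs)) :=
  BoundedFormula.realize_rel₂
@[simp] theorem realize_largeF : (largeF i s t).Realize v xs ↔
    large O i (s.realize (Sum.elim v xs)) (t.realize (Sum.elim v xs)) :=
  BoundedFormula.realize_rel₂
@[simp] theorem realize_conT (o : Option O) :
    (conT o : Tm O n).realize (Sum.elim v xs) = con O o := by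
  refine (Term.realize_func _ _ _).trans (congrArg _ (funext fun j => ?_))
  exact j.elim0
@[simp] theorem realize_regT : (regT i r s t).realize (Sum.elim v xs) =
    reg O i (r.realize (Sum.elim v xs)) (s.realize (Sum.elim v xs))
      (t.realize (Sum.elim v xs)) := by
  refine (Term.realize_func _ _ _).trans (congrArg _ (funext fun j => ?_))
  fin_cases j <;> rfl
@[simp] theorem realize_bndT : (bndT i r s t).realize (Sum.elim v xs) =
    bnd O i (r.realize (Sum.elim v xs)) (s.realize (Sum.elim v xs))
      (t.realize (Sum.elim v xs)) := by
  refine (Term.realize_func _ _ _).trans (congrArg _ (funext fun j => ?_))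
  fin_cases j <;> rfl

end Formulas

section Sentences

/-- The order is trichotomous. -/
def trichS (O : Type (u + 1)) : (reflLang O).Sentence :=
  ∀' ∀' (ltF (&0) (&1) ⊔ (&0 =' &1) ⊔ ltF (&1) (&0))
/-- The order is transitive. -/
def transS (O : Type (u + 1)) : (reflLang O).Sentence :=
  ∀' ∀' ∀' (ltF (&0) (&1) ⟹ ltF (&1) (&2) ⟹ ltF (&0) (&2))
/-- Relations that are not large carry a regressive function with bounded fibres. -/
def skolemS (O : Type (u + 1)) (i : ℕ) : (reflLang O).Sentence :=
  ∀' ∀' ∀' (∼(largeF i (&0) (&1)) ⟹ ltF (&2) (&1) ⟹ relF i (&0) (&2) ⟹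
    ((ltF (regT i (&0) (&1) (&2)) (&2) ⊔ ((regT i (&0) (&1) (&2)) =' (&1))) ⊓
      (∼(ltF (bndT i (&0) (&1) (regT i (&0) (&1) (&2))) (&2)) ⊓
        ltF (bndT i (&0) (&1) (regT i (&0) (&1) (&2))) (&1))))
/-- The `a`-th relation holds everywhere. -/
def everyS (O : Type (u + 1)) (a : ℕ) : (reflLang O).Sentence :=
  ∀' ∀' relF a (&0) (&1)
/-- The `a`-th relation and largeness of the `i`-th one imply the `s`-th one. -/
def pointwiseS (O : Type (u + 1)) (a i s : ℕ) : (reflLang O).Sentence :=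
  ∀' ∀' (relF a (&0) (&1) ⟹ largeF i (&0) (&1) ⟹ relF s (&0) (&1))
/-- The `a`-th relation and largeness of the `i`-th one at all parameters below the given one
imply the `s`-th relation. -/
def belowS (O : Type (u + 1)) (a i s : ℕ) : (reflLang O).Sentence :=
  ∀' ∀' (relF a (&0) (&1) ⟹ (∀' (ltF (&2) (&0) ⟹ largeF i (&2) (&1))) ⟹ relF s (&0) (&1))
/-- The `a`-th relation and largeness of the `i`-th one at all parameters below the given point
imply the `s`-th relation. -/
def diagS (O : Type (u + 1)) (a i s : ℕ) : (reflLang O).Sentence :=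
  ∀' ∀' (relF a (&0) (&1) ⟹ (∀' (ltF (&2) (&1) ⟹ largeF i (&2) (&1))) ⟹ relF s (&0) (&1))
/-- Points below `c` are distinguished by the `i`-th relation at parameters below `ν`. -/
def distinctS (i : ℕ) (c ν : O) : (reflLang O).Sentence :=
  ∀' ∀' (ltF (&0) (conT (some c)) ⟹ ltF (&1) (conT (some c)) ⟹
    (∀' (ltF (&2) (conT (some ν)) ⟹ ((relF i (&2) (&0)) ⇔ (relF i (&2) (&1))))) ⟹ (&0 =' &1))

variable {X : Type (u + 1)} [(reflLang O).Structure X]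

theorem realize_trichS : X ⊨ trichS O ↔ ∀ x y : X, lt O x y ∨ x = y ∨ lt O y x := by
  simp [trichS, Sentence.Realize, Formula.Realize, Fin.snoc, or_assoc]
theorem realize_transS : X ⊨ transS O ↔ ∀ x y z : X, lt O x y → lt O y z → lt O x z := by
  simp [transS, Sentence.Realize, Formula.Realize, Fin.snoc]
theorem realize_skolemS (i : ℕ) : X ⊨ skolemS O i ↔ ∀ β x z : X, ¬ large O i β x → lt O z x →
    rel O i β z → (lt O (reg O i β x z) z ∨ reg O i β x z = x) ∧
      ¬ lt O (bnd O i β x (reg O i β x z)) z ∧ lt O (bnd O i β x (reg O i β x z)) x := by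
  simp [skolemS, Sentence.Realize, Formula.Realize, Fin.snoc]
theorem realize_everyS (a : ℕ) : X ⊨ everyS O a ↔ ∀ β x : X, rel O a β x := by
  simp [everyS, Sentence.Realize, Formula.Realize, Fin.snoc]
theorem realize_pointwiseS (a i s : ℕ) : X ⊨ pointwiseS O a i s ↔
    ∀ β x : X, rel O a β x → large O i β x → rel O s β x := by
  simp [pointwiseS, Sentence.Realize, Formula.Realize, Fin.snoc]
theorem realize_belowS (a i s : ℕ) : X ⊨ belowS O a i s ↔
    ∀ β x : X, rel O a β x → (∀ γ, lt O γ β → large O i γ x) → rel O s β x := by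
  simp [belowS, Sentence.Realize, Formula.Realize, Fin.snoc]
theorem realize_diagS (a i s : ℕ) : X ⊨ diagS O a i s ↔
    ∀ β x : X, rel O a β x → (∀ γ, lt O γ x → large O i γ x) → rel O s β x := by
  simp [diagS, Sentence.Realize, Formula.Realize, Fin.snoc]
theorem realize_distinctS (i : ℕ) (c ν : O) : X ⊨ distinctS i c ν ↔
    ∀ x y : X, lt O x (con O (some c)) → lt O y (con O (some c)) →
      (∀ γ, lt O γ (con O (some ν)) → (rel O i γ x ↔ rel O i γ y)) → x = y := by
  simp [distinctS, Sentence.Realize, Formula.Realize, Fin.snoc]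

end Sentences

end Refl

/-! ### Reflection points -/

/-- `D i β` behaves like the statement that `Q i β` holds at a critical point `l` in a well-founded
extension of the ordinals up to `κ`. -/
structure IsReflectionPoint {ι : Type*} (κ : Ordinal.{u}) (Q : ι → Ordinal.{u} → Ordinal.{u} → Prop)
    (l : Ordinal.{u}) (D : ι → Ordinal.{u} → Prop) : Prop where
  le : l ≤ κ
  fodorLarge : ∀ i, ∀ β ≤ κ, D i β → FodorLarge (Q i β) l
  every : ∀ a, (∀ β x, Q a β x) → ∀ β ≤ κ, D a β
  pointwise : ∀ a i s, (∀ β x, Q a β x → FodorLarge (Q i β) x → Q s β x) →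
    ∀ β ≤ κ, D a β → D i β → D s β
  below : ∀ a i s, (∀ β x, Q a β x → (∀ γ < β, FodorLarge (Q i γ) x) → Q s β x) →
    ∀ β < l, D a β → (∀ γ < β, D i γ) → D s β
  diag : ∀ a i s, (∀ β x, Q a β x → (∀ γ < x, FodorLarge (Q i γ) x) → Q s β x) →
    ∀ β ≤ κ, D a β → (∀ γ < l, D i γ) → D s β
  distinct : ∀ i, ∀ c ≤ κ, l ≤ c → ∀ ν < l,
    (∀ x < c, ∀ y < c, (∀ γ < ν, Q i γ x ↔ Q i γ y) → x = y) →
    ∀ δ < c, ¬ ∀ γ < ν, D i γ ↔ Q i γ δ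

/-- The critical point argument, with `M` an abstract relation. Only the sentences actually needed
are assumed to transfer, and `D i β` is read off as `R i (j β) d`. -/
theorem exists_isReflectionPoint_of_extension {ι : Type*} {κ : Ordinal.{u}}
    {Q : ι → Ordinal.{u} → Ordinal.{u} → Prop}
    {M : Type*} {lt : M → M → Prop} {R Lg : ι → M → M → Prop} {k b : ι → M → M → M → M}
    {j : Ordinal.{u} → M} {e : M} (hwf : WellFounded lt)
    (tri : ∀ x y, lt x y ∨ x = y ∨ lt y x) (trans : ∀ x y z, lt x y → lt y z → lt x z)
    (jlt : ∀ x ≤ κ, ∀ y ≤ κ, x < y → lt (j x) (j y))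
    (jR : ∀ i, ∀ x ≤ κ, ∀ y ≤ κ, R i (j x) (j y) ↔ Q i x y)
    (jL : ∀ i, ∀ x ≤ κ, ∀ y ≤ κ, Lg i (j x) (j y) ↔ FodorLarge (Q i x) y)
    (jb : ∀ i, ∀ x ≤ κ, ∀ y ≤ κ, ∀ z ≤ κ, ∃ o ≤ κ, b i (j x) (j y) (j z) = j o)
    (he : lt e (j κ)) (he' : ∀ α < κ, e ≠ j α)
    (skolem : ∀ i β x z, ¬ Lg i β x → lt z x → R i β z →
      (lt (k i β x z) z ∨ k i β x z = x) ∧ ¬ lt (b i β x (k i β x z)) z ∧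
        lt (b i β x (k i β x z)) x)
    (every : ∀ a, (∀ β x, Q a β x) → ∀ β x, R a β x)
    (pointwise : ∀ a i s, (∀ β x, Q a β x → FodorLarge (Q i β) x → Q s β x) →
      ∀ β x, R a β x → Lg i β x → R s β x)
    (below : ∀ a i s, (∀ β x, Q a β x → (∀ γ < β, FodorLarge (Q i γ) x) → Q s β x) →
      ∀ β x, R a β x → (∀ γ, lt γ β → Lg i γ x) → R s β x)
    (diag : ∀ a i s, (∀ β x, Q a β x → (∀ γ < x, FodorLarge (Q i γ) x) → Q s β x) →
      ∀ β x, R a β x → (∀ γ, lt γ x → Lg i γ x) → R s β x)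
    (distinct : ∀ i, ∀ c ≤ κ, ∀ ν ≤ κ,
      (∀ x < c, ∀ y < c, (∀ γ < ν, Q i γ x ↔ Q i γ y) → x = y) →
      ∀ x y, lt x (j c) → lt y (j c) → (∀ γ, lt γ (j ν) → (R i γ x ↔ R i γ y)) → x = y) :
    ∃ l D, IsReflectionPoint κ Q l D := by
  have irr : ∀ x, ¬ lt x x := fun x h => hwf.asymmetric x x h h
  -- the critical point
  have hex : ∃ o, o ≤ κ ∧ ∃ m, lt m (j o) ∧ ∀ α < o, m ≠ j α := ⟨κ, le_rfl, e, he, he'⟩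
  obtain ⟨l, ⟨hl, hm⟩, hlmin⟩ := WellFounded.has_min Ordinal.lt_wf {o | _} hex
  -- The least new element below `j l`; it acts as the supremum of the `j α` with `α < l`.
  obtain ⟨d, ⟨hdl, hd⟩, hdmin⟩ := WellFounded.has_min hwf {m | _} hm
  have below_j : ∀ α < l, ∀ m, lt m (j α) → ∃ γ < α, m = j γ := by
    intro α hα m hmα
    by_contra! hno
    exact hlmin α ⟨hα.le.trans hl, m, hmα, hno⟩ hα
  have pred : ∀ m, lt m d → ∃ α < l, m = j α := by
    intro m hmd
    by_contra! hno
    exact hdmin m ⟨trans _ _ _ hmd hdl, hno⟩ hmd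
  have jd : ∀ α < l, lt (j α) d := by
    intro α hα
    rcases tri (j α) d with h | h | h
    · exact h
    · exact (hd α hα h.symm).elim
    · obtain ⟨γ, hγ, rfl⟩ := below_j α hα d h
      exact (hd γ (hγ.trans hα) rfl).elim
  have jle : ∀ x ≤ κ, ∀ y ≤ κ, lt (j x) (j y) → x < y := by
    intro x hx y hy h
    by_contra hn
    rcases (not_lt.1 hn).eq_or_lt with rfl | h'
    · exact irr _ h
    · exact irr _ (trans _ _ _ h (jlt y hy x hx h'))
  -- Otherwise apply the Skolem functions for `l` at `d`. The value is some `j γ`, so the bound for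
  -- its fibre is some `j o` with `o < l`; but then `j o < d`, although the bound is not below `d`.
  have large_at : ∀ i, ∀ β ≤ κ, R i (j β) d → FodorLarge (Q i β) l := by
    intro i β hβ hD
    by_contra hlarge
    obtain ⟨h1, h2, h3⟩ := skolem i (j β) (j l) d (fun h => hlarge ((jL i β hβ l hl).1 h)) hdl hD
    have : ∃ γ ≤ κ, k i (j β) (j l) d = j γ := by
      rcases h1 with h1 | h1
      · obtain ⟨γ, hγ, h⟩ := pred _ h1
        exact ⟨γ, hγ.le.trans hl, h⟩
      · exact ⟨l, hl, h1⟩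
    obtain ⟨γ, hγ, hkγ⟩ := this
    rw [hkγ] at h2 h3
    obtain ⟨o, ho, hbo⟩ := jb i β hβ l hl γ hγ
    rw [hbo] at h2 h3
    exact h2 (jd o (jle o ho l hl h3))
  -- A regressive function in `M` witnessing non-largeness at `d` takes values in `j '' l ∪ {d}`, so
  -- it pulls back to a witness against largeness at `l`.
  have large_up : ∀ i, ∀ β ≤ κ, R i (j β) d → Lg i (j β) d := by
    intro i β hβ hD
    by_contra hlarge
    have hL := large_at i β hβ hD
    classical
    -- pull back the regressive function and the bounds
    let p : M → Ordinal.{u} := fun m => if h : ∃ α < l, m = j α then h.choose else l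
    have p_spec : ∀ m, lt m d → p m < l ∧ j (p m) = m := by
      intro m hmd
      have h := pred m hmd
      have : p m = h.choose := dif_pos h
      rw [this]
      exact ⟨h.choose_spec.1, h.choose_spec.2.symm⟩
    have p_d : p d = l := dif_neg fun ⟨α, hα, h⟩ => hd α hα h
    -- The extra value of a regressive function is `l` outside and `d` inside `M`, so `l` must go to
    -- `d` here and not to `j l`.
    let j' : Ordinal.{u} → M := fun o => if o < l then j o else d
    refine hL (fun ζ => p (k i (j β) d (j ζ))) (fun γ => p (b i (j β) d (j' γ))) ?_
    intro z hz hQ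
    have hzκ := hz.le.trans hl
    obtain ⟨h1, h2, h3⟩ := skolem i (j β) d (j z) hlarge (jd z hz) ((jR i β hβ z hzκ).2 hQ)
    have hj' : j' (p (k i (j β) d (j z))) = k i (j β) d (j z) := by
      rcases h1 with h1 | h1
      · obtain ⟨ha, hb⟩ := p_spec _ (trans _ _ _ h1 (jd z hz))
        simp only [j', if_pos ha, hb]
      · rw [h1, p_d]
        simp [j']
    obtain ⟨hb1, hb2⟩ := p_spec _ h3
    refine ⟨?_, ?_, ?_⟩
    · rcases h1 with h1 | h1
      · obtain ⟨ha, hb⟩ := p_spec _ (trans _ _ _ h1 (jd z hz))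
        left
        refine jle _ (ha.le.trans hl) _ hzκ ?_
        rw [hb]
        exact h1
      · right
        simp only [h1, p_d]
    · simp only [hj']
      by_contra hn
      refine h2 ?_
      have := jlt _ (hb1.le.trans hl) _ hzκ (not_le.1 hn)
      rwa [hb2] at this
    · simp only [hj']
      exact hb1
  refine ⟨l, fun i β => R i (j β) d, ⟨hl, large_at, fun a h β _ => every a h _ _, ?_, ?_, ?_, ?_⟩⟩
  · intro a i s h β hβ ha hi
    exact pointwise a i s h _ _ ha (large_up i β hβ hi)
  · intro a i s h β hβ ha hi
    refine below a i s h _ _ ha fun m hm => ?_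
    obtain ⟨γ, hγ, rfl⟩ := below_j β hβ m hm
    exact large_up i γ ((hγ.trans hβ).le.trans hl) (hi γ hγ)
  · intro a i s h β hβ ha hi
    refine diag a i s h _ _ ha fun m hm => ?_
    obtain ⟨γ, hγ, rfl⟩ := pred m hm
    exact large_up i γ (hγ.le.trans hl) (hi γ hγ)
  · intro i c hc hlc ν hν h δ hδ hD
    have hdc : lt d (j c) := by
      rcases hlc.eq_or_lt with rfl | h
      · exact hdl
      · exact trans _ _ _ hdl (jlt l hl c hc h)
    -- For `ν < l` all parameters below `j ν` are standard, so agreement of `D` with `Q` at `δ` is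
    -- agreement of `d` with `j δ` in `M`.
    have hdδ : d = j δ := by
      refine distinct i c hc ν (hν.le.trans hl) h d (j δ) hdc
        (jlt δ (hδ.le.trans hc) c hc hδ) fun m hm => ?_
      obtain ⟨γ, hγ, rfl⟩ := below_j ν hν m hm
      rw [hD γ hγ, jR i γ ((hγ.trans hν).le.trans hl) δ (hδ.le.trans hc)]
    rcases lt_or_ge δ l with h' | h'
    · exact hd δ h' hdδ
    · rcases h'.eq_or_lt with rfl | h'
      · exact irr _ (hdδ ▸ hdl)
      · have := jlt l hl δ (hδ.le.trans hc) h'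
        rw [← hdδ] at this
        exact irr _ (trans _ _ _ this hdl)

/-! ### Reflection points from weak compactness -/

theorem mk_symbols_reflLang_le {O : Type (u + 1)} {c : Cardinal.{u + 1}} (hc : ℵ₀ ≤ c)
    (hO : #O ≤ c) : #(reflLang O).Symbols ≤ c := by
  let f : Option O ⊕ ULift.{u + 1} ((ℕ ⊕ ℕ) ⊕ Option (ℕ ⊕ ℕ)) → (reflLang O).Symbols
    | Sum.inl o => Sum.inl ⟨0, ReflFun.const o⟩
    | Sum.inr ⟨Sum.inl (Sum.inl i)⟩ => Sum.inl ⟨3, ReflFun.regr i⟩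
    | Sum.inr ⟨Sum.inl (Sum.inr i)⟩ => Sum.inl ⟨3, ReflFun.bound i⟩
    | Sum.inr ⟨Sum.inr none⟩ => Sum.inr ⟨2, ReflRel.lt⟩
    | Sum.inr ⟨Sum.inr (some (Sum.inl i))⟩ => Sum.inr ⟨2, ReflRel.rel i⟩
    | Sum.inr ⟨Sum.inr (some (Sum.inr i))⟩ => Sum.inr ⟨2, ReflRel.large i⟩
  have hf : Function.Surjective f := by
    rintro (⟨_, o | i | i⟩ | ⟨_, _ | i | i⟩)
    · exact ⟨Sum.inl o, rfl⟩
    · exact ⟨Sum.inr ⟨Sum.inl (Sum.inl i)⟩, rfl⟩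
    · exact ⟨Sum.inr ⟨Sum.inl (Sum.inr i)⟩, rfl⟩
    · exact ⟨Sum.inr ⟨Sum.inr none⟩, rfl⟩
    · exact ⟨Sum.inr ⟨Sum.inr (some (Sum.inl i))⟩, rfl⟩
    · exact ⟨Sum.inr ⟨Sum.inr (some (Sum.inr i))⟩, rfl⟩
  refine (Cardinal.mk_le_of_surjective hf).trans ?_
  rw [Cardinal.mk_sum, Cardinal.lift_id, Cardinal.lift_id, Cardinal.mk_option]
  exact Cardinal.add_le_of_le hc
    (Cardinal.add_le_of_le hc hO (Cardinal.one_le_aleph0.trans hc))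
    (Cardinal.mk_le_aleph0.trans hc)

/-- The interpretation of the language on a set of ordinals, with the extra constant at `p`. -/
@[reducible]
def ordinalStructure {O : Type (u + 1)} (Q : ℕ → Ordinal.{u} → Ordinal.{u} → Prop)
    (val : O → Ordinal.{u}) (mk : Ordinal.{u} → O) (p : O) : (reflLang O).Structure O where
  funMap := fun f => match f with
    | ReflFun.const o => fun _ => o.getD p
    | ReflFun.regr i => fun v => mk (regr (Q i (val (v 0))) (val (v 1)) (val (v 2)))
    | ReflFun.bound i => fun v => mk (fibreBound (Q i (val (v 0))) (val (v 1)) (val (v 2)))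
  RelMap := fun r => match r with
    | ReflRel.lt => fun v => val (v 0) < val (v 1)
    | ReflRel.rel i => fun v => Q i (val (v 0)) (val (v 1))
    | ReflRel.large i => fun v => FodorLarge (Q i (val (v 0))) (val (v 1))

namespace DefLogic

variable {L : DefLogic.{u}}

-- Builds the `κ` structures on `κ + 1` and checks that each transferred sentence fails in at most
-- one of them.
open FirstOrder Language Refl in
theorem exists_isReflectionPoint_nat (hL : L.IsProper) (hwf : L.ExpressesWellFounded)
    {κ : Cardinal.{u}} (hκ : κ ∈ L.WCS) (Q : ℕ → Ordinal.{u} → Ordinal.{u} → Prop) :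
    ∃ l D, IsReflectionPoint κ.ord Q l D := by
  -- the elements of the structure are the ordinals up to `κ`
  let O : ZFSet.{u} := (κ.ord + 1).toZFSet
  let val : O → Ordinal.{u} := fun x => x.1.rank
  have mem_O : ∀ o : Ordinal.{u}, (min o κ.ord).toZFSet ∈ O := fun o =>
    Ordinal.toZFSet_mem_toZFSet_iff.2 (lt_of_le_of_lt (min_le_right _ _) (Order.lt_add_one_iff.2 le_rfl))
  -- Truncation at `κ` keeps arbitrary values of the Skolem functions inside the structure; the
  -- values that matter are at most `κ`.
  let mk : Ordinal.{u} → O := fun o => ⟨(min o κ.ord).toZFSet, mem_O o⟩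
  have : Nonempty O := ⟨mk 0⟩
  have val_mk : ∀ o ≤ κ.ord, val (mk o) = o := fun o ho => by
    simp only [val, mk, Ordinal.rank_toZFSet, min_eq_left ho]
  have mk_val : ∀ x : O, val x ≤ κ.ord ∧ mk (val x) = x := by
    rintro ⟨x, hx⟩
    obtain ⟨a, ha, rfl⟩ := Ordinal.mem_toZFSet_iff.1 hx
    have ha' := Order.lt_add_one_iff.1 ha
    refine ⟨by simpa only [val, Ordinal.rank_toZFSet] using ha', Subtype.ext ?_⟩
    simp only [val, mk, Ordinal.rank_toZFSet, min_eq_left ha']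
  have val_inj : ∀ x y : O, val x = val y → x = y := fun x y h => by
    rw [← (mk_val x).2, ← (mk_val y).2, h]
  have hcardO : #O = Cardinal.lift.{u + 1} κ := by
    have h1 : (κ.ord + 1).card = κ := by
      rw [Ordinal.card_add, Cardinal.card_ord, Ordinal.card_one]
      exact Cardinal.add_one_eq hκ.1.le
    rw [ZFSet.cardinalMk_coe_sort, Ordinal.card_toZFSet, h1]
  have hcard : #(reflLang O).Symbols ≤ Cardinal.lift.{u + 1} κ :=
    mk_symbols_reflLang_le (Cardinal.aleph0_le_lift.2 hκ.1.le) hcardO.le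
  obtain ⟨M, hM, strM, hMwf, hMS⟩ := exists_wellFounded_model hL hwf hκ hcard
    (ReflRel.lt : (reflLang O).Relations 2)
    (fun p : Set.Iio κ.ord => ordinalStructure Q val mk (mk p))
    (by simp) (fun p => InvImage.wf val Ordinal.lt_wf)
  have hall : ∀ ψ : (reflLang O).Sentence,
      (∀ p : O, val p < κ.ord → letI := ordinalStructure Q val mk p; O ⊨ ψ) → M ⊨ ψ := fun ψ h =>
    hMS ψ fun i _ hi _ => (hi (h _ (by rw [val_mk _ (le_of_lt i.2)]; exact i.2))).elim
  have hatom : ∀ φ : Fm O 0,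
      (∀ p : O, val p < κ.ord → letI := ordinalStructure Q val mk p;
        φ.Realize (Empty.elim : Empty → O) Fin.elim0) →
      φ.Realize (Empty.elim : Empty → M) Fin.elim0 := by
    intro φ h
    have := hall φ fun p hp => by
      let := ordinalStructure Q val mk p
      have := h p hp
      simp only [Sentence.Realize, Formula.Realize]
      convert this
    simp only [Sentence.Realize, Formula.Realize] at this
    convert this
  refine exists_isReflectionPoint_of_extension (κ := κ.ord) (Q := Q) (lt := lt O) (R := rel O)
    (Lg := large O) (k := reg O) (b := bnd O) (j := fun o => con O (some (mk o)))
    (e := con O none) hMwf ?_ ?_ ?_ ?_ ?_ ?_ ?_ ?_ ?_ ?_ ?_ ?_ ?_ ?_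
  · refine realize_trichS.1 (hall _ fun p _ => ?_)
    let := ordinalStructure Q val mk p
    refine realize_trichS.2 fun x y => ?_
    rcases lt_trichotomy (val x) (val y) with h | h | h
    · exact Or.inl h
    · exact Or.inr (Or.inl (val_inj _ _ h))
    · exact Or.inr (Or.inr h)
  · refine realize_transS.1 (hall _ fun p _ => ?_)
    let := ordinalStructure Q val mk p
    exact realize_transS.2 fun x y z h h' => lt_trans (show val x < val y from h) h'
  · intro x hx y hy hxy
    have := hatom (ltF (conT (some (mk x))) (conT (some (mk y)))) fun p _ => by
      let := ordinalStructure Q val mk p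
      simp only [realize_ltF, realize_conT]
      change val (mk x) < val (mk y)
      rwa [val_mk x hx, val_mk y hy]
    simpa only [realize_ltF, realize_conT] using this
  · intro i x hx y hy
    by_cases hQ : Q i x y
    · refine iff_of_true ?_ hQ
      have := hatom (relF i (conT (some (mk x))) (conT (some (mk y)))) fun p _ => by
        let := ordinalStructure Q val mk p
        simp only [realize_relF, realize_conT]
        change Q i (val (mk x)) (val (mk y))
        rwa [val_mk x hx, val_mk y hy]
      simpa only [realize_relF, realize_conT] using this
    · refine iff_of_false ?_ hQ
      have := hatom (∼(relF i (conT (some (mk x))) (conT (some (mk y))))) fun p _ => by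
        let := ordinalStructure Q val mk p
        simp only [BoundedFormula.realize_not, realize_relF, realize_conT]
        change ¬ Q i (val (mk x)) (val (mk y))
        rwa [val_mk x hx, val_mk y hy]
      simpa only [BoundedFormula.realize_not, realize_relF, realize_conT] using this
  · intro i x hx y hy
    by_cases hQ : FodorLarge (Q i x) y
    · refine iff_of_true ?_ hQ
      have := hatom (largeF i (conT (some (mk x))) (conT (some (mk y)))) fun p _ => by
        let := ordinalStructure Q val mk p
        simp only [realize_largeF, realize_conT]
        change FodorLarge (Q i (val (mk x))) (val (mk y))
        rwa [val_mk x hx, val_mk y hy]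
      simpa only [realize_largeF, realize_conT] using this
    · refine iff_of_false ?_ hQ
      have := hatom (∼(largeF i (conT (some (mk x))) (conT (some (mk y))))) fun p _ => by
        let := ordinalStructure Q val mk p
        simp only [BoundedFormula.realize_not, realize_largeF, realize_conT]
        change ¬ FodorLarge (Q i (val (mk x))) (val (mk y))
        rwa [val_mk x hx, val_mk y hy]
      simpa only [BoundedFormula.realize_not, realize_largeF, realize_conT] using this
  · intro i x hx y hy z hz
    -- The interpretation of the bound does not depend on `p`, and `w` has a constant, so this
    -- equation holds in all the structures.
    let w : O := mk (fibreBound (Q i (val (mk x))) (val (mk y)) (val (mk z)))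
    refine ⟨val w, (mk_val w).1, ?_⟩
    have := hatom (bndT i (conT (some (mk x))) (conT (some (mk y))) (conT (some (mk z))) ='
        conT (some w)) fun p _ => by
      let := ordinalStructure Q val mk p
      simp only [BoundedFormula.realize_bdEqual, realize_bndT, realize_conT]
      rfl
    simpa only [BoundedFormula.realize_bdEqual, realize_bndT, realize_conT, (mk_val w).2] using this
  · have := hatom (ltF (conT none) (conT (some (mk κ.ord)))) fun p hp => by
      let := ordinalStructure Q val mk p
      simp only [realize_ltF, realize_conT]
      change val p < val (mk κ.ord)
      rwa [val_mk _ le_rfl]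
    simpa only [realize_ltF, realize_conT] using this
  · intro α hα
    -- The only sentences that are not true in every structure: each fails exactly where the extra
    -- constant is `α`.
    have key := hMS (∼(conT none =' conT (some (mk α)))) fun p q hp hq => by
      have aux : ∀ p : Set.Iio κ.ord, ¬ (let := ordinalStructure Q val mk (mk p.1)
          O ⊨ (∼(conT none =' conT (some (mk α))) : (reflLang O).Sentence)) → p.1 = α := by
        intro p hp
        let := ordinalStructure Q val mk (mk p.1)
        simp only [Sentence.Realize, Formula.Realize, BoundedFormula.realize_not,
          BoundedFormula.realize_bdEqual, realize_conT, not_not] at hp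
        have hp' : mk p.1 = mk α := hp
        rw [← val_mk p.1 (le_of_lt p.2), hp', val_mk α hα.le]
      exact Subtype.ext ((aux p hp).trans (aux q hq).symm)
    simpa only [Sentence.Realize, Formula.Realize, BoundedFormula.realize_not,
      BoundedFormula.realize_bdEqual, realize_conT] using key
  · intro i
    refine (realize_skolemS i).1 (hall _ fun p _ => ?_)
    let := ordinalStructure Q val mk p
    refine (realize_skolemS i).2 fun β x z hL hz hR => ?_
    change ¬ FodorLarge (Q i (val β)) (val x) at hL
    change val z < val x at hz
    change Q i (val β) (val z) at hR
    obtain ⟨h1, h2, h3⟩ := boundedFibres_regr hL (val z) hz hR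
    set k := regr (Q i (val β)) (val x) (val z) with hk
    have hkx : k ≤ val x := h1.elim (fun h => (h.trans hz).le) le_of_eq
    have hreg : val (reg O i β x z) = k := val_mk k (hkx.trans (mk_val x).1)
    have hbnd : val (bnd O i β x (reg O i β x z)) = fibreBound (Q i (val β)) (val x) k := by
      change val (mk (fibreBound (Q i (val β)) (val x) (val (reg O i β x z)))) = _
      rw [hreg]
      exact val_mk _ (h3.le.trans (mk_val x).1)
    change (val (reg O i β x z) < val z ∨ _) ∧ ¬ val (bnd O i β x (reg O i β x z)) < val z ∧
      val (bnd O i β x (reg O i β x z)) < val x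
    rw [hbnd, hreg, not_lt]
    exact ⟨h1.imp_right fun h => val_inj _ _ (hreg.trans h), h2, h3⟩
  · intro a h
    refine (realize_everyS a).1 (hall _ fun p _ => ?_)
    let := ordinalStructure Q val mk p
    exact (realize_everyS a).2 fun β x => h _ _
  · intro a i s h
    refine (realize_pointwiseS a i s).1 (hall _ fun p _ => ?_)
    let := ordinalStructure Q val mk p
    exact (realize_pointwiseS a i s).2 fun β x => h _ _
  · intro a i s h
    refine (realize_belowS a i s).1 (hall _ fun p _ => ?_)
    let := ordinalStructure Q val mk p
    refine (realize_belowS a i s).2 fun β x hβ hγ => h _ _ hβ fun γ hγβ => ?_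
    have hv := val_mk γ (hγβ.le.trans (mk_val β).1)
    have := hγ (mk γ) (show val (mk γ) < val β by rwa [hv])
    change FodorLarge (Q i (val (mk γ))) (val x) at this
    rwa [hv] at this
  · intro a i s h
    refine (realize_diagS a i s).1 (hall _ fun p _ => ?_)
    let := ordinalStructure Q val mk p
    refine (realize_diagS a i s).2 fun β x hβ hγ => h _ _ hβ fun γ hγβ => ?_
    have hv := val_mk γ (hγβ.le.trans (mk_val x).1)
    have := hγ (mk γ) (show val (mk γ) < val x by rwa [hv])
    change FodorLarge (Q i (val (mk γ))) (val x) at this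
    rwa [hv] at this
  · intro i c hc ν hν h
    refine (realize_distinctS i (mk c) (mk ν)).1 (hall _ fun p _ => ?_)
    let := ordinalStructure Q val mk p
    refine (realize_distinctS i (mk c) (mk ν)).2 fun x y hx hy hxy => val_inj _ _ ?_
    change val x < val (mk c) at hx
    change val y < val (mk c) at hy
    rw [val_mk c hc] at hx hy
    refine h _ hx _ hy fun γ hγ => ?_
    have hv := val_mk γ (hγ.le.trans hν)
    have := hxy (mk γ) (show val (mk γ) < val (mk ν) by rwa [hv, val_mk ν hν])
    change Q i (val (mk γ)) (val x) ↔ Q i (val (mk γ)) (val y) at this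
    rwa [hv] at this

theorem exists_isReflectionPoint (hL : L.IsProper) (hwf : L.ExpressesWellFounded)
    {κ : Cardinal.{u}} (hκ : κ ∈ L.WCS) {ι : Type} [Encodable ι]
    (Q : ι → Ordinal.{u} → Ordinal.{u} → Prop) :
    ∃ l D, IsReflectionPoint κ.ord Q l D := by
  obtain ⟨l, D, h⟩ := exists_isReflectionPoint_nat hL hwf hκ
    -- Natural numbers that encode nothing get the relation that always holds.
    (fun i β x => ∀ a : ι, Encodable.encode a = i → Q a β x)
  have hQ : ∀ (a : ι) β x, (∀ a' : ι, Encodable.encode a' = Encodable.encode a → Q a' β x) ↔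
      Q a β x := fun a β x =>
    ⟨fun h => h a rfl, fun h a' ha' => Encodable.encode_injective ha' ▸ h⟩
  refine ⟨l, fun a => D (Encodable.encode a), h.le, ?_, ?_, ?_, ?_, ?_, ?_⟩
  · intro i
    simpa only [hQ] using h.fodorLarge (Encodable.encode i)
  · intro a
    simpa only [hQ] using h.every (Encodable.encode a)
  · intro a i s
    simpa only [hQ] using
      h.pointwise (Encodable.encode a) (Encodable.encode i) (Encodable.encode s)
  · intro a i s
    simpa only [hQ] using h.below (Encodable.encode a) (Encodable.encode i) (Encodable.encode s)
  · intro a i s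
    simpa only [hQ] using h.diag (Encodable.encode a) (Encodable.encode i) (Encodable.encode s)
  · intro i
    simpa only [hQ] using h.distinct (Encodable.encode i)

end DefLogic

/-! ### Largeness, stationarity and Mahlo cardinals -/

/-- The initial ordinals of the cardinals in a class. -/
def IsOrdOf (P : Cardinal.{u} → Prop) (x : Ordinal.{u}) : Prop := ∃ l : Cardinal.{u}, P l ∧ l.ord = x

namespace FodorLarge

variable {P P' : Ordinal.{u} → Prop} {l : Ordinal.{u}}

theorem mono (h : FodorLarge P l) (hP : ∀ x, P x → P' x) : FodorLarge P' l :=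
  fun k b hkb => h k b fun z hz hz' => hkb z hz (hP z hz')

theorem exists_gt (h : FodorLarge P l) {x : Ordinal.{u}} (hx : x < l) : ∃ z < l, P z ∧ x < z := by
  by_contra! hno
  -- If `P` is bounded by `x` below `l`, the constant extra value `l` has one fibre, bounded by `x`.
  exact h (fun _ => l) (fun _ => x) fun z hz hPz => ⟨Or.inr rfl, hno z hz hPz, hx⟩

theorem exists_lt (h : FodorLarge P l) : ∃ z < l, P z := by
  by_contra! hno
  exact h id id fun z hz hPz => (hno z hz hPz).elim

/-- If a club misses `P`, send `z` in `P` to a bound below `z` for the part of the club below `z`.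
The next club element above a value bounds its fibre. -/
theorem isStationary (h : FodorLarge P l) : IsStationary {x : Set.Iio l | P x.1} := by
  classical
  by_contra hstat
  obtain ⟨C, hC, hdisj⟩ := not_isStationary_iff.1 hstat
  -- elements of `P` are not limits of the club
  have gap : ∀ z < l, P z → z ≠ 0 → ∃ w < z, ∀ c ∈ C, c.1 < z → c.1 ≤ w := by
    intro z hz hPz hz0
    by_contra! hno
    have hzC : (⟨z, hz⟩ : Set.Iio l) ∉ C := fun hzC =>
      Set.disjoint_left.1 hdisj (show (⟨z, hz⟩ : Set.Iio l) ∈ {x : Set.Iio l | P x.1} from hPz) hzC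
    refine hzC (hC.dirSupClosed (d := {c ∈ C | c.1 < z}) (fun c hc => hc.1) ?_
      (fun a ha b hb => (le_total a b).elim (fun hab => ⟨b, hb, hab, le_rfl⟩)
        fun hba => ⟨a, ha, le_rfl, hba⟩) ⟨?_, ?_⟩)
    · obtain ⟨c, hc, hcz, -⟩ := hno 0 (pos_iff_ne_zero.2 hz0)
      exact ⟨c, hc, hcz⟩
    · intro c hc
      exact (le_of_lt hc.2 : c.1 ≤ z)
    · intro w hw
      by_contra hwz
      obtain ⟨c, hc, hcz, hwc⟩ := hno w.1 (not_le.1 hwz)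
      exact absurd (hw ⟨hc, hcz⟩ : c ≤ w) (not_le.2 hwc)
  let k : Ordinal.{u} → Ordinal.{u} := fun z =>
    if h : ∃ w < z, ∀ c ∈ C, c.1 < z → c.1 ≤ w then h.choose else l
  let b : Ordinal.{u} → Ordinal.{u} := fun γ =>
    if γ = l then 0 else sInf {o | γ < o ∧ ∃ c ∈ C, c.1 = o}
  refine h k b fun z hz hPz => ?_
  by_cases hz0 : z = 0
  · have hk : k z = l := dif_neg fun ⟨w, hw, _⟩ => by
      rw [hz0] at hw
      exact absurd hw (not_lt.2 zero_le)
    have hb : b (k z) = 0 := if_pos hk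
    rw [hb]
    exact ⟨Or.inr hk, hz0.le, hz0 ▸ hz⟩
  · have hw := gap z hz hPz hz0
    have hk : k z = hw.choose := dif_pos hw
    obtain ⟨h1, h2⟩ := hw.choose_spec
    rw [← hk] at h1 h2
    have hb : b (k z) = sInf {o | k z < o ∧ ∃ c ∈ C, c.1 = o} := if_neg (h1.trans hz).ne
    obtain ⟨c, hc, hzc⟩ := hC.isCofinal ⟨z, hz⟩
    have hne : {o | k z < o ∧ ∃ c ∈ C, c.1 = o}.Nonempty :=
      ⟨c.1, h1.trans_le hzc, c, hc, rfl⟩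
    rw [hb]
    refine ⟨Or.inl h1, le_csInf hne ?_, ?_⟩
    · rintro _ ⟨ho, c', hc', rfl⟩
      by_contra hn
      exact absurd (h2 c' hc' (not_le.1 hn)) (not_le.2 ho)
    · obtain ⟨-, c', -, hc'⟩ := csInf_mem hne
      rw [← hc']
      exact c'.2

/-- If the cofinality `μ` is below `l`, send each `z > μ` to the index of a member of a cofinal
`μ`-sequence that is at least `z`. That member bounds the fibre, and the points up to `μ` take the
extra value `l`. -/
theorem ord_cof_eq (h : FodorLarge P l) : l.cof.ord = l := by
  classical
  refine le_antisymm (Ordinal.ord_cof_le l) (not_lt.1 fun hlt => ?_)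
  obtain ⟨μ, hμ⟩ : ∃ μ, l.cof.ord = μ := ⟨_, rfl⟩
  obtain ⟨f, hf⟩ := Ordinal.exists_isFundamentalSeq hμ
  rw [hμ] at hlt
  have hex : ∀ z < l, ∃ ξ, ∃ hξ : ξ < μ, z ≤ (f ⟨ξ, hξ⟩).1 := by
    intro z hz
    obtain ⟨_, ⟨ξ, rfl⟩, hle⟩ := hf.isCofinal_range ⟨z, hz⟩
    exact ⟨ξ.1, ξ.2, hle⟩
  choose! g hgμ hg using hex
  refine h (fun z => if z ≤ μ then l else g z)
    (fun ξ => if hξ : ξ < μ then (f ⟨ξ, hξ⟩).1 else μ) fun z hz _ => ?_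
  by_cases hzμ : z ≤ μ
  · simp only [if_pos hzμ, dif_neg (not_lt.2 hlt.le)]
    exact ⟨Or.inr trivial, hzμ, hlt⟩
  · simp only [if_neg hzμ, dif_pos (hgμ z hz)]
    exact ⟨Or.inl ((hgμ z hz).trans (not_le.1 hzμ)), hg z hz, (f _).2⟩

theorem isSuccLimit (h : FodorLarge P l) : Order.IsSuccLimit l := by
  rcases Ordinal.zero_or_succ_or_isSuccLimit l with rfl | ⟨μ, rfl⟩ | hl
  · obtain ⟨z, hz, -⟩ := h.exists_lt
    exact absurd hz (not_lt.2 zero_le)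
  · obtain ⟨z, hz, -, hz'⟩ := h.exists_gt (Order.lt_succ μ)
    exact absurd hz' (not_lt.2 (Order.lt_succ_iff.1 hz))
  · exact hl

/-- The predecessor function is regressive and injective on nonzero natural numbers; zero takes the
extra value. -/
theorem not_fodorLarge_omega0 : ¬ FodorLarge P Ordinal.omega0 := by
  intro h
  refine h (fun z => if z = 0 then Ordinal.omega0 else Ordinal.pred z)
    (fun γ => if γ = Ordinal.omega0 then 0 else γ + 1) fun z hz _ => ?_
  obtain ⟨n, rfl⟩ := Ordinal.lt_omega0.1 hz
  rcases n with _ | n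
  · simp
  · have h0 : ((n + 1 : ℕ) : Ordinal.{u}) ≠ 0 := by exact_mod_cast Nat.succ_ne_zero n
    have hp : Ordinal.pred ((n + 1 : ℕ) : Ordinal.{u}) = n := by
      rw [Nat.cast_succ]
      exact Ordinal.pred_add_one _
    have hn : ((n : ℕ) : Ordinal.{u}) ≠ Ordinal.omega0 := (Ordinal.natCast_lt_omega0 n).ne
    simp only [if_neg h0, hp, if_neg hn]
    refine ⟨Or.inl (by exact_mod_cast Nat.lt_succ_self n), by rw [Nat.cast_succ], ?_⟩
    exact_mod_cast Ordinal.natCast_lt_omega0 (n + 1)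

theorem isRegular (h : FodorLarge P l) : IsOrdOf (fun θ => ℵ₀ < θ ∧ θ.IsRegular) l := by
  have hlim := h.isSuccLimit
  have hreg := Cardinal.isRegular_cof hlim
  refine ⟨l.cof, ⟨lt_of_le_of_ne hreg.aleph0_le fun h0 => ?_, hreg⟩, h.ord_cof_eq⟩
  have := h.ord_cof_eq
  rw [← h0, Cardinal.ord_aleph0] at this
  subst this
  exact not_fodorLarge_omega0 h

theorem stationaryBelow {R : Cardinal.{u} → Prop} {θ : Cardinal.{u}}
    (h : FodorLarge (IsOrdOf R) θ.ord) : StationaryBelow R θ :=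
  h.isStationary

/-- Regularity comes from largeness alone. Unboundedly many regular cardinals below make the point a
limit cardinal. -/
theorem isWeaklyMahlo (h : FodorLarge (IsOrdOf Cardinal.IsRegular) l) :
    IsOrdOf IsWeaklyMahlo l := by
  obtain ⟨θ, ⟨hθ, hreg⟩, rfl⟩ := h.isRegular
  refine ⟨θ, ⟨⟨hθ, hreg, ?_⟩, h.stationaryBelow⟩, rfl⟩
  refine (Order.isSuccLimit_iff θ).2 ⟨?_, Order.isSuccPrelimit_of_succ_lt fun μ hμ => ?_⟩
  · exact fun hmin => absurd (hmin zero_le) (not_le.2 hreg.pos)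
  · obtain ⟨_, hz, ⟨ν, -, rfl⟩, hμν⟩ := h.exists_gt (Cardinal.ord_lt_ord.2 hμ)
    exact (Order.succ_le_of_lt (Cardinal.ord_lt_ord.1 hμν)).trans_lt (Cardinal.ord_lt_ord.1 hz)

end FodorLarge

/-! ### Mahlo properties of reflection points -/

namespace IsReflectionPoint

variable {ι : Type} {κ : Ordinal.{u}} {l : Ordinal.{u}} {t r : ι}
  {Q : ι → Ordinal.{u} → Ordinal.{u} → Prop} {D : ι → Ordinal.{u} → Prop}

/-- Bootstrapping from nothing: the trivial relation holds at the critical point, and its largeness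
implies regularity. -/
theorem regular (h : IsReflectionPoint κ Q l D) (ht : ∀ β x, Q t β x)
    (hr : ∀ β x, Q r β x ↔ IsOrdOf Cardinal.IsRegular x) {β : Ordinal.{u}} (hβ : β ≤ κ) : D r β :=
  h.pointwise t t r (fun β x _ hx => (hr β x).2 <|
    let ⟨θ, hθ, hx⟩ := hx.isRegular
    ⟨θ, hθ.2, hx⟩) β hβ (h.every t ht β hβ) (h.every t ht β hβ)

theorem isWeaklyMahlo (h : IsReflectionPoint κ Q l D) (ht : ∀ β x, Q t β x)
    (hr : ∀ β x, Q r β x ↔ IsOrdOf Cardinal.IsRegular x) : IsOrdOf IsWeaklyMahlo l := by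
  refine FodorLarge.isWeaklyMahlo ((h.fodorLarge r 0 zero_le ?_).mono fun x => (hr 0 x).1)
  exact h.regular ht hr zero_le

theorem weaklyMahlo (h : IsReflectionPoint κ Q l D) (ht : ∀ β x, Q t β x)
    (hr : ∀ β x, Q r β x ↔ IsOrdOf Cardinal.IsRegular x) {w : ι}
    (hw : ∀ β x, Q w β x ↔ IsOrdOf IsWeaklyMahlo x) {β : Ordinal.{u}} (hβ : β ≤ κ) : D w β :=
  h.pointwise t r w (fun β x _ hx => (hw β x).2 (hx.mono fun y => (hr β y).1).isWeaklyMahlo)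
    β hβ (h.every t ht β hβ) (h.regular ht hr hβ)

end IsReflectionPoint

/-- A class with a member below `κ` has a least member, which lies below `κ`. -/
theorem exists_isLeast_lt {P : Cardinal.{u} → Prop} {l : Ordinal.{u}} {κ : Cardinal.{u}}
    (h : FodorLarge (IsOrdOf P) l) (hl : l ≤ κ.ord) : ∃ μ, IsLeast {θ | P θ} μ ∧ μ < κ := by
  obtain ⟨_, hz, θ, hθ, rfl⟩ := h.exists_lt
  have hne : {θ | P θ}.Nonempty := ⟨θ, hθ⟩
  exact ⟨sInf {θ | P θ}, ⟨csInf_mem hne, fun _ h => csInf_le' h⟩,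
    (csInf_le' hθ).trans_lt (Cardinal.ord_lt_ord.1 (hz.trans_le hl))⟩

/-! ### Least hyper-Mahlo cardinals and successors of the continuum -/

namespace DefLogic

variable {L : DefLogic.{u}} {κ : Cardinal.{u}}

theorem exists_isLeast_isWeaklyHyperMahlo (hL : L.IsProper) (hwf : L.ExpressesWellFounded)
    (hκ : κ ∈ L.WCS) (n : ℕ) : ∃ μ, IsLeast {θ | IsWeaklyHyperMahlo n θ} μ ∧ μ < κ := by
  let Q : Option (Option ℕ) → Ordinal.{u} → Ordinal.{u} → Prop
    | none => fun _ _ => True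
    | some none => fun _ => IsOrdOf Cardinal.IsRegular
    | some (some n) => fun _ => IsOrdOf (IsWeaklyHyperMahlo n)
  obtain ⟨l, D, h⟩ := exists_isReflectionPoint hL hwf hκ Q
  have wm : ∀ β ≤ κ.ord, D (some (some 0)) β := fun β hβ =>
    h.weaklyMahlo (t := none) (r := some none) (fun _ _ => trivial) (fun _ _ => Iff.rfl)
      (fun _ _ => Iff.rfl) hβ
  have hD : ∀ n, ∀ β ≤ κ.ord, D (some (some n)) β := by
    intro n
    induction n with
    | zero => exact wm
    | succ n ih =>
      intro β hβ
      -- One Mahlo step: weakly Mahlo, together with largeness of level `n`, gives level `n + 1`.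
      refine h.pointwise (some (some 0)) (some (some n)) (some (some (n + 1))) ?_ β hβ (wm β hβ)
        (ih β hβ)
      rintro β _ ⟨θ, hθ, rfl⟩ hx
      exact ⟨θ, ⟨hθ, FodorLarge.stationaryBelow hx⟩, rfl⟩
  exact exists_isLeast_lt (h.fodorLarge (some (some n)) 0 zero_le (hD n 0 zero_le)) h.le

theorem exists_isLeast_isWeaklyDiagHyperMahlo (hL : L.IsProper) (hwf : L.ExpressesWellFounded)
    (hκ : κ ∈ L.WCS) (n : ℕ) : ∃ μ, IsLeast {θ | IsWeaklyDiagHyperMahlo n θ} μ ∧ μ < κ := by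
  let Q : Option (Option (ℕ ⊕ ℕ)) → Ordinal.{u} → Ordinal.{u} → Prop
    | none => fun _ _ => True
    | some none => fun _ => IsOrdOf Cardinal.IsRegular
    | some (some (Sum.inl n)) => fun _ => IsOrdOf (IsWeaklyDiagHyperMahlo n)
    | some (some (Sum.inr n)) => fun β => IsOrdOf (MahloIter (IsWeaklyDiagHyperMahlo n) β)
  obtain ⟨l, D, h⟩ := exists_isReflectionPoint hL hwf hκ Q
  have hD : ∀ n, ∀ β ≤ κ.ord, D (some (some (Sum.inl n))) β := by
    intro n
    induction n with
    | zero =>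
      exact fun β hβ => h.weaklyMahlo (t := none) (r := some none) (fun _ _ => trivial)
        (fun _ _ => Iff.rfl) (fun _ _ => Iff.rfl) hβ
    | succ n ih =>
      -- The iterates are handled by induction on the parameter `β`. Restricting to `β < l` ensures
      -- that all parameters below `j β` are standard, and the diagonal step needs no others, since
      -- it only quantifies over parameters below `d`.
      have hiter : ∀ β, β < l → D (some (some (Sum.inr n))) β := by
        intro β
        induction β using WellFoundedLT.induction with
        | ind β ihβ =>
          intro hβ
          refine h.below (some (some (Sum.inl n))) (some (some (Sum.inr n)))
            (some (some (Sum.inr n))) ?_ β hβ (ih β (hβ.le.trans h.le))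
            fun γ hγ => ihβ γ hγ (hγ.trans hβ)
          rintro β _ ⟨θ, hθ, rfl⟩ hx
          refine ⟨θ, ?_, rfl⟩
          rw [MahloIter]
          exact ⟨hθ, fun γ => FodorLarge.stationaryBelow (hx γ.1 γ.2)⟩
      intro β hβ
      refine h.diag (some (some (Sum.inl n))) (some (some (Sum.inr n)))
        (some (some (Sum.inl (n + 1)))) ?_ β hβ (ih β hβ) hiter
      rintro β _ ⟨θ, hθ, rfl⟩ hx
      refine ⟨θ, ?_, rfl⟩
      rw [show IsWeaklyDiagHyperMahlo (n + 1) θ ↔ MahloIter (IsWeaklyDiagHyperMahlo n) θ.ord θ from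
        Iff.rfl, MahloIter]
      exact ⟨hθ, fun γ => FodorLarge.stationaryBelow (hx γ.1 γ.2)⟩
  exact exists_isLeast_lt (h.fodorLarge (some (some (Sum.inl n))) 0 zero_le
    (hD n 0 zero_le)) h.le

theorem iterate_succ_continuum_notMem_WCS (hL : L.IsProper) (hwf : L.ExpressesWellFounded)
    (n : ℕ) : Order.succ^[n] ((2 : Cardinal.{u}) ^ (ℵ₀ : Cardinal.{u})) ∉ L.WCS := by
  classical
  intro hκ
  set c : Cardinal.{u} := 2 ^ (ℵ₀ : Cardinal.{u}) with hc
  set κ := Order.succ^[n] c with hκdef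
  have hcκ : c ≤ κ := Order.le_succ_iterate n c
  -- an enumeration of the sets of natural numbers
  have hcard : #(Set.Iio c.ord) = #(ULift.{u + 1} (Set ℕ)) := by simp [hc]
  obtain ⟨e⟩ := Cardinal.eq.1 hcard
  -- The value beyond the continuum is irrelevant: only points below it are compared.
  let E : Ordinal.{u} → Set ℕ := fun x => if hx : x < c.ord then (e ⟨x, hx⟩).down else ∅
  let Q : Option (Option Unit) → Ordinal.{u} → Ordinal.{u} → Prop
    | none => fun _ _ => True
    | some none => fun _ => IsOrdOf Cardinal.IsRegular
    | some (some _) => fun γ x => ∃ m : ℕ, γ = m ∧ m ∈ E x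
  obtain ⟨l, D, h⟩ := exists_isReflectionPoint hL hwf hκ Q
  obtain ⟨θ, hθ, rfl⟩ := h.isWeaklyMahlo (t := none) (r := some none) (fun _ _ => trivial)
    (fun _ _ => Iff.rfl)
  have hθκ : θ ≤ κ := Cardinal.ord_le_ord.1 h.le
  have hθc : θ ≤ c := by
    by_contra hcθ
    -- A limit cardinal above `c` is above all its finite successors.
    have : ∀ m : ℕ, Order.succ^[m] c < θ := by
      intro m
      induction m with
      | zero => exact not_le.1 hcθ
      | succ m ih =>
        rw [Function.iterate_succ_apply']
        exact hθ.1.2.2.succ_lt ih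
    exact absurd (this n) (not_lt.2 hθκ)
  have hω : Ordinal.omega0 < θ.ord := by
    rw [← Cardinal.ord_aleph0]
    exact Cardinal.ord_lt_ord.2 hθ.1.1
  have mem_iff : ∀ (m : ℕ) x, Q (some (some ())) m x ↔ m ∈ E x := fun m x =>
    ⟨fun ⟨m', hm, h⟩ => by rwa [Nat.cast_injective hm], fun h => ⟨m, rfl, h⟩⟩
  -- The index of the set of natural numbers coded by the critical point.
  let δ := e.symm ⟨{m : ℕ | D (some (some ())) m}⟩
  refine h.distinct (some (some ())) c.ord (Cardinal.ord_le_ord.2 hcκ) (Cardinal.ord_le_ord.2 hθc)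
    Ordinal.omega0 hω ?_ δ.1 δ.2 ?_
  · intro x hx y hy hxy
    have : E x = E y := by
      ext m
      rw [← mem_iff, ← mem_iff]
      exact hxy m (Ordinal.natCast_lt_omega0 m)
    simp only [E, dif_pos hx, dif_pos hy] at this
    exact congrArg Subtype.val (e.injective (ULift.down_injective this))
  · intro γ hγ
    obtain ⟨m, rfl⟩ := Ordinal.lt_omega0.1 hγ
    have hEδ : E δ.1 = {m : ℕ | D (some (some ())) m} := by
      have : E δ.1 = (e δ).down := dif_pos δ.2
      rw [this, Equiv.apply_symm_apply]
    rw [mem_iff, hEδ]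
    rfl

theorem exists_mem_WCS_of_wcn_lt_top (h : L.wcn < ⊤) :
    ∃ κ ∈ L.WCS, L.wcn = (κ : WithTop Cardinal.{u}) := by
  have hne : ((fun κ : Cardinal.{u} => (κ : WithTop Cardinal.{u})) '' L.WCS).Nonempty := by
    by_contra hempty
    rw [Set.not_nonempty_iff_eq_empty] at hempty
    rw [wcn, hempty, WithTop.sInf_empty] at h
    exact lt_irrefl _ h
  obtain ⟨κ, hκ, hκ'⟩ := csInf_mem hne
  exact ⟨κ, hκ, hκ'.symm⟩

end DefLogic

end

theorem proposition3p4 (L : DefLogic.{u}) (hproper : L.IsProper) (hfin : L.IsFinitary)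
    (htruth : L.TruthfulAtRegular) (hwf : L.ExpressesWellFounded) :
    (L.wcn < ⊤ →
      (∀ n : ℕ, ∃ μ : Cardinal.{u}, IsLeast {l | IsWeaklyHyperMahlo n l} μ ∧
        (μ : WithTop Cardinal.{u}) < L.wcn) ∧
      (∀ n : ℕ, ∃ μ : Cardinal.{u}, IsLeast {l | IsWeaklyDiagHyperMahlo n l} μ ∧
        (μ : WithTop Cardinal.{u}) < L.wcn)) ∧
    (∀ n : ℕ, (Order.succ^[n] ((2 : Cardinal.{u}) ^ (ℵ₀ : Cardinal.{u}))) ∉ L.WCS) := by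
  refine ⟨fun h => ?_, DefLogic.iterate_succ_continuum_notMem_WCS hproper hwf⟩
  obtain ⟨κ, hκ, hwcn⟩ := DefLogic.exists_mem_WCS_of_wcn_lt_top h
  rw [hwcn]
  refine ⟨fun n => ?_, fun n => ?_⟩
  · obtain ⟨μ, hμ, hlt⟩ := DefLogic.exists_isLeast_isWeaklyHyperMahlo hproper hwf hκ n
    exact ⟨μ, hμ, WithTop.coe_lt_coe.2 hlt⟩
  · obtain ⟨μ, hμ, hlt⟩ := DefLogic.exists_isLeast_isWeaklyDiagHyperMahlo hproper hwf hκ n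
    exact ⟨μ, hμ, WithTop.coe_lt_coe.2 hlt⟩
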